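/- All graphs are finite, simple and undirected; $e(G)$ denotes the number of edges of $G$. A graph $G$ is $k$-connected if $|V(G)|\ge k+1$ and $G-U$ is connected for every $U\subset V(G)$ with $|U|\le k-1$. An edge-colouring of $G$ (adjacent edges may have the same colour) is monochromatic $k$-connected if any two distinct vertices of $G$ are connected by $k$ distinct, pairwise internally vertex-disjoint paths, each of which has all of its edges in a single colour (different paths may have different colours). For a $k$-connected graph $G$, the monochromatic $k$-connection number $mc_k(G)$ is the maximum number of colours used in a monochromatic $k$-connected edge-colouring of $G$. A minimum spanning $k$-connected subgraph of $G$ is a $k$-connected subgraph $H\subset G$ with $V(H)=V(G)$ for which $e(H)$ is minimum. **Theorem.** Let $t\ge s\ge k$, where $k\in\{2,3\}$. Let $G$ be a $k$-connected bipartite graph whose partition classes have $s$ and $t$ vertices, and let $H\subset G$ be a minimum spanning $k$-connected subgraph. If $e(H)=kt$, then \[ mc_k(G)=e(G)-kt+1. \] Moreover, if $s=t$, then the same conclusion holds for every $k\in\{2,3,4,5\}$ (with $t=s\ge k$). -/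

import Mathlib

namespace MonoConn

variable {V : Type*}

/-- The number of edges `e(G)` of a (finite) graph. -/
noncomputable def numEdges (G : SimpleGraph V) : ℕ := G.edgeSet.ncard

/-- `G` is `k`-connected: it has at least `k + 1` vertices, and deleting any set of fewer than `k`
vertices leaves a connected graph. -/
def IsKConnected (G : SimpleGraph V) (k : ℕ) : Prop :=
  k + 1 ≤ Nat.card V ∧
    ∀ U : Finset V, U.card < k → (G.induce {v : V | v ∉ U}).Connected

/-- `H` is a minimum spanning `k`-connected subgraph of `G`: a `k`-connected subgraph with the same
vertex set as `G`, having the least number of edges among all such subgraphs. -/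
def IsMinSpanningKConnected (G H : SimpleGraph V) (k : ℕ) : Prop :=
  H ≤ G ∧ IsKConnected H k ∧
    ∀ H' : SimpleGraph V, H' ≤ G → IsKConnected H' k → numEdges H ≤ numEdges H'

/-- All edges of the walk `p` have the same colour under the edge-colouring `φ`. -/
def IsMonochromatic {G : SimpleGraph V} {C : Type*} (φ : G.EdgeLabeling C) {u v : V}
    (p : G.Walk u v) : Prop :=
  ∃ c : C, ∀ (e : Sym2 V) (he : e ∈ p.edges), φ ⟨e, p.edges_subset_edgeSet he⟩ = c

/-- The edge-colouring `φ` is monochromatic `k`-connected: any two (distinct) vertices are connected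
by `k` different, pairwise internally vertex-disjoint, monochromatic paths. -/
def IsMonoKConnected {G : SimpleGraph V} {C : Type*} (φ : G.EdgeLabeling C) (k : ℕ) : Prop :=
  ∀ u v : V, u ≠ v → ∃ P : Fin k → G.Path u v,
    Function.Injective P ∧
    (∀ i j : Fin k, i ≠ j → ∀ x : V,
      x ∈ (P i : G.Walk u v).support → x ∈ (P j : G.Walk u v).support → x = u ∨ x = v) ∧
    ∀ i : Fin k, IsMonochromatic φ (P i : G.Walk u v)

/-- The set of all numbers `m` such that some monochromatic `k`-connected edge-colouring of `G`
uses exactly `m` colours. -/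
def colourCounts (G : SimpleGraph V) (k : ℕ) : Set ℕ :=
  {m | ∃ (r : ℕ) (φ : G.EdgeLabeling (Fin r)), IsMonoKConnected φ k ∧ (Set.range φ).ncard = m}

/-- The monochromatic `k`-connection number `mc_k(G)`: the maximum number of colours in a
monochromatic `k`-connected edge-colouring of `G`. (For finite `G` the set `colourCounts G k` is
bounded by the number of edges, so the supremum is a maximum whenever such a colouring exists;
it is `0` otherwise.) -/
noncomputable def mc (G : SimpleGraph V) (k : ℕ) : ℕ := sSup (colourCounts G k)

end MonoConn

/-! Lower bound: paint the spanning subgraph `H` in one colour and give every other edge a private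
colour. Menger's theorem, proved by induction on the number of edges, finds the `k` paths inside
`H`.

Upper bound: if colour `c` has `e_c` edges, the number of colours is `e(G) - ∑ (e_c - 1)`, so the
claim becomes `∑ (e_c - 1) ≥ kt - 1` (`mul_le_sum`). Put `t = #Y = m + 1`. Over ordered pairs of
distinct vertices of `Y`, the prescribed paths number `k m (m + 1)`. A colour with degrees `d`
serves `(u, v)` at most `min (d u) (d v)` times, hence contributes at most `m e_c` in all, and at
most `m (e_c - 1)` unless it is large, i.e. spans `Y` with at least `2t` edges
(`sum_offDiag_add_le`). Therefore `kt ≤ ∑ (e_c - 1) + #large` (`side_bound`), which suffices when at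
most one colour is large.

Two large colours have enough edges by themselves when `k ≤ 3`, and three when `k ≤ 5`. If `s = t`
and exactly two remain, the count from the `X` side lets both be assumed to span `X` as well;
equality would then force a vertex of `X` onto two paths that must be disjoint. -/

namespace MonoConn

variable {V : Type*}

/-! ### Menger's theorem for two vertex sets -/

/-- Every walk from `A` to `B` meets `S`. -/
def Separates (G : SimpleGraph V) (A B S : Set V) : Prop :=
  ∀ a ∈ A, ∀ b ∈ B, ∀ w : G.Walk a b, ∃ x ∈ w.support, x ∈ S

/-- Some walk from `A` to `v` avoids `S`. -/
def ReachAvoiding (G : SimpleGraph V) (A S : Set V) (v : V) : Prop :=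
  ∃ a ∈ A, ∃ w : G.Walk a v, ∀ x ∈ w.support, x ∉ S

/-- A family of `k` pairwise disjoint paths from `A` to `B`. -/
structure Linkage (G : SimpleGraph V) (A B : Set V) (k : ℕ) where
  src : Fin k → V
  tgt : Fin k → V
  walk : ∀ i, G.Walk (src i) (tgt i)
  src_mem : ∀ i, src i ∈ A
  tgt_mem : ∀ i, tgt i ∈ B
  isPath : ∀ i, (walk i).IsPath
  disj : ∀ i j x, x ∈ (walk i).support → x ∈ (walk j).support → i = j

theorem Separates.symm {G : SimpleGraph V} {A B S : Set V} (h : Separates G A B S) :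
    Separates G B A S := fun b hb a ha w => by
  obtain ⟨x, hx, hxS⟩ := h a ha b hb w.reverse
  exact ⟨x, by simpa using hx, hxS⟩

theorem Separates.not_reachAvoiding {G : SimpleGraph V} {A B S : Set V} (h : Separates G A B S)
    {v : V} (hA : ReachAvoiding G A S v) : ¬ ReachAvoiding G B S v := by
  rintro ⟨b, hb, q, hq⟩
  obtain ⟨a, ha, p, hp⟩ := hA
  obtain ⟨x, hx, hxS⟩ := h a ha b hb (p.append q.reverse)
  rw [SimpleGraph.Walk.mem_support_append_iff] at hx
  rcases hx with hx | hx
  · exact hp x hx hxS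
  · exact hq x (by simpa using hx) hxS

theorem exists_walk_first_hit {G : SimpleGraph V} (Z : Set V) {a b : V} (w : G.Walk a b)
    (h : ∃ x ∈ w.support, x ∈ Z) :
    ∃ z ∈ Z, ∃ p : G.Walk a z, p.support ⊆ w.support ∧ ∀ x ∈ p.support, x ∈ Z → x = z := by
  induction w with
  | nil =>
    rename_i u
    obtain ⟨x, hx, hxZ⟩ := h
    simp only [SimpleGraph.Walk.support_nil, List.mem_singleton] at hx
    subst hx
    exact ⟨x, hxZ, .nil, by simp, by simp⟩
  | cons hadj w ih =>
    rename_i u v c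
    by_cases hu : u ∈ Z
    · exact ⟨u, hu, .nil, by simp, by simp⟩
    · obtain ⟨x, hx, hxZ⟩ := h
      have hx' : x ∈ w.support := by
        rcases List.mem_cons.1 (by simpa using hx) with rfl | h
        · exact absurd hxZ hu
        · exact h
      obtain ⟨z, hz, p, hp, hpz⟩ := ih ⟨x, hx', hxZ⟩
      refine ⟨z, hz, .cons hadj p, ?_, ?_⟩
      · intro y hy
        simp only [SimpleGraph.Walk.support_cons, List.mem_cons] at hy ⊢
        exact hy.imp_right fun h => hp h
      · intro y hy hyZ
        simp only [SimpleGraph.Walk.support_cons, List.mem_cons] at hy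
        rcases hy with rfl | hy
        · exact absurd hyZ hu
        · exact hpz y hy hyZ

theorem exists_walk_deleteEdges {G : SimpleGraph V} {x y a b : V} (w : G.Walk a b)
    (h : s(x, y) ∉ w.edges) :
    ∃ p : (G.deleteEdges {s(x, y)}).Walk a b, p.support = w.support := by
  refine ⟨w.toDeleteEdges _ (by rintro e he rfl; exact h he), ?_⟩
  exact SimpleGraph.Walk.support_transfer ..

/-- If `S` separates `A` from `B` once the edge `xy` is deleted and `y` is not reachable from `A`
then a set separating `A` from `S ∪ {x}` separates `A` from `B` in the whole graph. -/
theorem separates_of_separates_deleteEdges {G : SimpleGraph V} {A B S T : Set V} {x y : V}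
    (hxy : x ≠ y)
    (hS : Separates (G.deleteEdges {s(x, y)}) A B S)
    (hy : ¬ ReachAvoiding (G.deleteEdges {s(x, y)}) A S y) (hyS : y ∉ S)
    (hT : Separates (G.deleteEdges {s(x, y)}) A (insert x S) T) : Separates G A B T := by
  intro a ha b hb w
  have hit : ∃ v ∈ w.support, v ∈ insert y (insert x S) := by
    by_cases he : s(x, y) ∈ w.edges
    · exact ⟨x, w.fst_mem_support_of_mem_edges he, by simp⟩
    · obtain ⟨p, hp⟩ := exists_walk_deleteEdges w he
      obtain ⟨v, hv, hvS⟩ := hS a ha b hb p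
      exact ⟨v, hp ▸ hv, by simp [hvS]⟩
  obtain ⟨z, hz, p, hpw, hpz⟩ := exists_walk_first_hit _ w hit
  have he : s(x, y) ∉ p.edges := fun he => hxy <|
    (hpz x (p.fst_mem_support_of_mem_edges he) (by simp)).trans
      (hpz y (p.snd_mem_support_of_mem_edges he) (by simp)).symm
  obtain ⟨q, hq⟩ := exists_walk_deleteEdges p he
  rcases hz with rfl | hz
  · refine absurd ⟨a, ha, q, fun v hv hvS => ?_⟩ hy
    rw [hpz v (hq ▸ hv) (by simp [hvS])] at hvS
    exact hyS hvS
  · obtain ⟨v, hv, hvT⟩ := hT a ha z hz q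
    exact ⟨v, hpw (hq ▸ hv), hvT⟩

namespace Linkage

variable {G : SimpleGraph V} {A B : Set V} {k : ℕ}

theorem tgt_injective (L : Linkage G A B k) : Function.Injective L.tgt := fun i j h =>
  L.disj i j (L.tgt i) (L.walk i).end_mem_support (by rw [h]; exact (L.walk j).end_mem_support)

/-- Pigeonhole: `k` disjoint paths have `k` different ends, which exhaust `T`. Consequently a path
meets `T` only at its own end (`eq_tgt`). -/
theorem exists_tgt_eq {T : Finset V} (L : Linkage G A T k) (hT : T.card ≤ k) {x : V}
    (hx : x ∈ T) : ∃ i, L.tgt i = x := by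
  classical
  have h : Finset.univ.image L.tgt = T := by
    apply Finset.eq_of_subset_of_card_le
    · intro v hv
      obtain ⟨i, -, rfl⟩ := Finset.mem_image.1 hv
      exact L.tgt_mem i
    · rw [Finset.card_image_of_injective _ L.tgt_injective]
      simpa using hT
  rw [← h] at hx
  obtain ⟨i, -, hi⟩ := Finset.mem_image.1 hx
  exact ⟨i, hi⟩

theorem eq_tgt {T : Finset V} (L : Linkage G A T k) (hT : T.card ≤ k) {x : V}
    (hx : x ∈ T) {i : Fin k} (hi : x ∈ (L.walk i).support) : x = L.tgt i := by
  obtain ⟨j, rfl⟩ := L.exists_tgt_eq hT hx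
  rw [L.disj i j _ hi (L.walk j).end_mem_support]

/-- Away from the separator the paths of a linkage into `S ∪ {x}` are reachable from `A`. -/
theorem reachAvoiding [DecidableEq V] {S : Finset V} {x : V} (L : Linkage G A ↑(insert x S) k)
    (hT : (insert x S).card ≤ k) {v : V} (hv : v ∉ S) {i : Fin k}
    (hi : v ∈ (L.walk i).support) : ReachAvoiding G A S v := by
  refine ⟨_, L.src_mem i, (L.walk i).takeUntil v hi, fun y hy hyS => ?_⟩
  have hy' := (L.walk i).support_takeUntil_subset_support hi hy
  have hyt := L.eq_tgt hT (Finset.mem_insert_of_mem hyS) hy'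
  by_cases hvt : v = L.tgt i
  · exact hv (hvt ▸ hyt ▸ hyS)
  · subst hyt
    exact SimpleGraph.Walk.endpoint_notMem_support_takeUntil (L.isPath i) hi (Ne.symm hvt) hy

end Linkage

/-- Two linkages from `A` and `B` into the two ends of a cut are glued along the cut. -/
theorem nonempty_linkage_of_glue [DecidableEq V] {G G' : SimpleGraph V} (hG : G' ≤ G)
    {A B : Set V} {S : Finset V} {x y : V} {k : ℕ} (hxS : x ∉ S) (hyS : y ∉ S) (hxy : G.Adj x y)
    (hk : S.card + 1 = k) (hS : Separates G' A B S)
    (P : Linkage G' A ↑(insert x S) k) (Q : Linkage G' B ↑(insert y S) k) :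
    Nonempty (Linkage G A B k) := by
  have hcx : (insert x S).card ≤ k := by rw [Finset.card_insert_of_notMem hxS]; omega
  have hcy : (insert y S).card ≤ k := by rw [Finset.card_insert_of_notMem hyS]; omega
  -- A path ending in `S` continues along the `Q`-path with the same end; the one ending at `x`
  -- crosses the edge `xy`.
  have key : ∀ i, ∃ j, (P.tgt i ∈ S → Q.tgt j = P.tgt i) ∧ (P.tgt i ∉ S → Q.tgt j = y) := by
    intro i
    by_cases h : P.tgt i ∈ S
    · obtain ⟨j, hj⟩ := Q.exists_tgt_eq hcy (Finset.mem_insert_of_mem h)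
      exact ⟨j, fun _ => hj, fun h' => absurd h h'⟩
    · obtain ⟨j, hj⟩ := Q.exists_tgt_eq hcy (Finset.mem_insert_self y S)
      exact ⟨j, fun h' => absurd h' h, fun _ => hj⟩
  choose σ hσ₁ hσ₂ using key
  have hPx : ∀ i, P.tgt i ∉ S → P.tgt i = x := fun i hi =>
    (Finset.mem_insert.1 (P.tgt_mem i)).resolve_right hi
  have hσ : ∀ i j, σ i = σ j → i = j := by
    intro i j hij
    apply P.tgt_injective
    by_cases hi : P.tgt i ∈ S <;> by_cases hj : P.tgt j ∈ S
    · rw [← hσ₁ i hi, ← hσ₁ j hj, hij]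
    · exact absurd (hσ₂ j hj ▸ hij ▸ hσ₁ i hi ▸ hi) hyS
    · exact absurd (hσ₂ i hi ▸ hij ▸ hσ₁ j hj ▸ hj) hyS
    · rw [hPx i hi, hPx j hj]
  have cross : ∀ i j v, v ∈ (P.walk i).support → v ∈ (Q.walk (σ j)).support → i = j := by
    intro i j v hp hq
    by_cases hv : v ∈ S
    · have h1 := P.eq_tgt hcx (Finset.mem_insert_of_mem hv) hp
      have h2 := Q.eq_tgt hcy (Finset.mem_insert_of_mem hv) hq
      apply P.tgt_injective
      by_cases hj : P.tgt j ∈ S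
      · rw [← hσ₁ j hj, ← h1, h2]
      · exact absurd (hσ₂ j hj ▸ h2 ▸ hv) hyS
    · exact absurd (Q.reachAvoiding hcy hv hq)
        (hS.not_reachAvoiding (P.reachAvoiding hcx hv hp))
  have walks : ∀ i, ∃ w : G.Walk (P.src i) (Q.src (σ i)), w.IsPath ∧ ∀ v ∈ w.support,
      v ∈ (P.walk i).support ∨ v ∈ (Q.walk (σ i)).support := by
    intro i
    have main : ∃ w : G.Walk (P.src i) (Q.src (σ i)), ∀ v ∈ w.support,
      v ∈ (P.walk i).support ∨ v ∈ (Q.walk (σ i)).support := by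
      by_cases hi : P.tgt i ∈ S
      · refine ⟨((P.walk i).mapLe hG).append
          ((((Q.walk (σ i)).mapLe hG).reverse).copy (hσ₁ i hi) rfl), fun v hv => ?_⟩
        simpa [SimpleGraph.Walk.mem_support_append_iff] using hv
      · have hadj : G.Adj (P.tgt i) (Q.tgt (σ i)) := by
          rw [hPx i hi, hσ₂ i hi]; exact hxy
        refine ⟨((P.walk i).mapLe hG).append
          (.cons hadj (((Q.walk (σ i)).mapLe hG).reverse)), fun v hv => ?_⟩
        simp only [SimpleGraph.Walk.mem_support_append_iff, SimpleGraph.Walk.support_cons,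
          List.mem_cons, SimpleGraph.Walk.support_mapLe_eq_support,
          SimpleGraph.Walk.support_reverse, List.mem_reverse] at hv
        rcases hv with h | rfl | h
        · exact .inl h
        · exact .inl (P.walk i).end_mem_support
        · exact .inr h
    obtain ⟨w, hw⟩ := main
    exact ⟨w.bypass, w.bypass_isPath, fun v hv => hw v (w.support_bypass_subset_support hv)⟩
  choose w hwp hw using walks
  refine ⟨⟨_, _, w, P.src_mem, fun i => Q.src_mem _, hwp, fun i j v hi hj => ?_⟩⟩
  rcases hw i v hi with h1 | h1 <;> rcases hw j v hj with h2 | h2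
  · exact P.disj i j v h1 h2
  · exact cross i j v h1 h2
  · exact (cross j i v h2 h1).symm
  · exact hσ i j (Q.disj _ _ v h1 h2)

/-- **Menger's theorem**, for two sets of vertices. -/
theorem nonempty_linkage [Finite V] (G : SimpleGraph V) (A B : Set V) (k : ℕ)
    (h : ∀ S : Finset V, Separates G A B S → k ≤ S.card) : Nonempty (Linkage G A B k) := by
  classical
  induction hn : G.edgeSet.ncard using Nat.strong_induction_on generalizing G A B with
  | _ n ih =>
  have := Fintype.ofFinite V
  by_cases hbot : ∃ x y, G.Adj x y
  · by_cases hall : ∃ x y, G.Adj x y ∧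
        ∀ S : Finset V, Separates (G.deleteEdges {s(x, y)}) A B S → k ≤ S.card
    · obtain ⟨x, y, hxy, hS⟩ := hall
      have hlt : (G.deleteEdges {s(x, y)}).edgeSet.ncard < n := by
        rw [← hn, SimpleGraph.edgeSet_deleteEdges]
        exact Set.ncard_sdiff_singleton_lt_of_mem hxy
      obtain ⟨L⟩ := ih _ hlt _ A B hS rfl
      have hle := G.deleteEdges_le {s(x, y)}
      exact ⟨⟨L.src, L.tgt, fun i => (L.walk i).mapLe hle, L.src_mem, L.tgt_mem,
        fun i => (L.isPath i).mapLe hle, fun i j v hi hj =>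
          L.disj i j v (by simpa using hi) (by simpa using hj)⟩⟩
    · push Not at hall
      obtain ⟨x₀, y₀, hxy₀⟩ := hbot
      obtain ⟨S, hS, hcard⟩ := hall x₀ y₀ hxy₀
      have hns : ¬ Separates G A B S := fun h' => absurd (h S h') (by omega)
      unfold Separates at hns
      push Not at hns
      obtain ⟨a, ha, b, hb, w, hw⟩ := hns
      set G' := G.deleteEdges {s(x₀, y₀)} with hG'
      have haR : ReachAvoiding G' A S a :=
        ⟨a, ha, .nil, by simpa using hw a w.start_mem_support⟩
      have hbR : ¬ ReachAvoiding G' A S b := fun hb' =>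
        hS.not_reachAvoiding hb' ⟨b, hb, .nil, by simpa using hw b w.end_mem_support⟩
      -- The step at which `w` leaves the part reachable from `A` must be the deleted edge; this
      -- also fixes which end `x` lies on the `A` side.
      obtain ⟨d, hd, hd1, hd2⟩ := w.exists_boundary_dart {v | ReachAvoiding G' A S v} haR hbR
      obtain ⟨⟨x, y⟩, hxy⟩ := d
      have hxS : x ∉ S := hw x (w.dart_fst_mem_support_of_mem_darts hd)
      have hyS : y ∉ S := hw y (w.dart_snd_mem_support_of_mem_darts hd)
      change ReachAvoiding G' A S x at hd1
      change ¬ ReachAvoiding G' A S y at hd2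
      change G.Adj x y at hxy
      have heq : s(x, y) = s(x₀, y₀) := by
        by_contra hne
        apply hd2
        obtain ⟨a', ha', p, hp⟩ := hd1
        have hadj : G'.Adj x y := by
          rw [hG', SimpleGraph.deleteEdges_adj]
          exact ⟨hxy, hne⟩
        refine ⟨a', ha', p.concat hadj, fun v hv => ?_⟩
        rw [SimpleGraph.Walk.support_concat] at hv
        simp only [List.mem_append, List.mem_singleton] at hv
        rcases hv with hv | rfl
        · exact hp v hv
        · exact hyS
      rw [← heq] at hG'
      have hlt : G'.edgeSet.ncard < n := by
        rw [← hn, hG', SimpleGraph.edgeSet_deleteEdges]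
        exact Set.ncard_sdiff_singleton_lt_of_mem hxy
      have hxB : ¬ ReachAvoiding G' B S x := hS.not_reachAvoiding hd1
      have sepx : ∀ T : Finset V, Separates G' A ↑(insert x S) T → Separates G A B T := by
        intro T hT
        rw [hG'] at hS hd2 hT
        rw [Finset.coe_insert] at hT
        exact separates_of_separates_deleteEdges hxy.ne hS hd2 hyS hT
      have sepy : ∀ T : Finset V, Separates G' B ↑(insert y S) T → Separates G A B T := by
        intro T hT
        rw [hG', Sym2.eq_swap] at hS hxB hT
        rw [Finset.coe_insert] at hT
        exact (separates_of_separates_deleteEdges hxy.ne.symm hS.symm hxB hxS hT).symm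
      obtain ⟨P⟩ := ih _ hlt G' A ↑(insert x S) (fun T hT => h T (sepx T hT)) rfl
      obtain ⟨Q⟩ := ih _ hlt G' B ↑(insert y S) (fun T hT => h T (sepy T hT)) rfl
      -- `S ∪ {x}` meets every walk ending in it, so by `sepx` it separates `A` from `B` in `G` and
      -- has at least `k` elements.
      have hk : S.card + 1 = k := by
        have := h (insert x S) (sepx _ fun a _ b hb w => ⟨b, w.end_mem_support, hb⟩)
        rw [Finset.card_insert_of_notMem hxS] at this
        omega
      exact nonempty_linkage_of_glue (hG' ▸ G.deleteEdges_le _) hxS hyS hxy hk hS P Q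
  · push Not at hbot
    have hsep : Separates G A B ((A ∩ B).toFinset : Finset V) := by
      intro a ha b hb w
      cases w with
      | nil => exact ⟨a, by simp, by simp [ha, hb]⟩
      | cons hadj _ => exact absurd hadj (hbot _ _)
    obtain ⟨T, hT, hTk⟩ := Finset.exists_subset_card_eq (h _ hsep)
    let e := T.equivFinOfCardEq hTk
    have hmem : ∀ i, (e.symm i : V) ∈ A ∩ B := fun i => by
      simpa using hT (e.symm i).2
    exact ⟨⟨fun i => e.symm i, fun i => e.symm i, fun i => .nil, fun i => (hmem i).1,
      fun i => (hmem i).2, fun i => .nil, fun i j v hi hj => by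
        simp only [SimpleGraph.Walk.support_nil, List.mem_singleton] at hi hj
        exact e.symm.injective (Subtype.ext (hi.symm.trans hj))⟩⟩

/-! ### Menger's theorem for two vertices -/

theorem exists_walk_avoiding_ends {G : SimpleGraph V} {u v : V} (huv : u ≠ v)
    (hna : ¬ G.Adj u v) (w : G.Walk u v) :
    ∃ a b, G.Adj u a ∧ G.Adj v b ∧ ∃ p : G.Walk a b, u ∉ p.support ∧ v ∉ p.support ∧
      p.support ⊆ w.support := by
  classical
  obtain ⟨q, hq, hqw⟩ : ∃ q : G.Walk u v, q.IsPath ∧ q.support ⊆ w.support :=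
    ⟨w.bypass, w.bypass_isPath, w.support_bypass_subset_support⟩
  cases q with
  | nil => exact absurd rfl huv
  | cons hadj q =>
    rename_i a
    rw [SimpleGraph.Walk.cons_isPath_iff] at hq
    obtain ⟨r, hr⟩ : ∃ r : G.Walk v a, r = q.reverse := ⟨_, rfl⟩
    have hrp : r.IsPath := hr ▸ hq.1.reverse
    have hrs : ∀ x, x ∈ r.support ↔ x ∈ q.support := by simp [hr]
    cases r with
    | nil => exact absurd hadj hna
    | cons hadj' r =>
      rename_i b
      rw [SimpleGraph.Walk.cons_isPath_iff] at hrp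
      refine ⟨a, b, hadj, hadj', r.reverse, ?_, by simpa using hrp.2, ?_⟩
      · intro hu
        refine hq.2 ((hrs u).1 ?_)
        simp only [SimpleGraph.Walk.support_cons, List.mem_cons]
        exact .inr (by simpa using hu)
      · intro x hx
        apply hqw
        simp only [SimpleGraph.Walk.support_cons, List.mem_cons]
        refine .inr ((hrs x).1 ?_)
        simp only [SimpleGraph.Walk.support_cons, List.mem_cons]
        exact .inr (by simpa using hx)

/-- **Menger's theorem** for two nonadjacent vertices. -/
theorem exists_paths_of_not_adj [Finite V] {G : SimpleGraph V} {u v : V} (huv : u ≠ v)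
    (hna : ¬ G.Adj u v) (k : ℕ)
    (h : ∀ S : Finset V, u ∉ S → v ∉ S → S.card < k →
      ∃ w : G.Walk u v, ∀ x ∈ w.support, x ∉ S) :
    ∃ P : Fin k → G.Path u v, Function.Injective P ∧ ∀ i j, i ≠ j → ∀ x,
      x ∈ (P i : G.Walk u v).support → x ∈ (P j : G.Walk u v).support → x = u ∨ x = v := by
  classical
  let G₀ : SimpleGraph V := G.deleteEdges {e | u ∈ e ∨ v ∈ e}
  have hG₀ : G₀ ≤ G := G.deleteEdges_le _
  obtain ⟨L⟩ : Nonempty (Linkage G₀ {a | G.Adj u a} {b | G.Adj v b} k) := by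
    apply nonempty_linkage
    intro S hS
    by_contra! hlt
    -- `S` may contain `u` or `v`; erasing them is harmless because the trimmed walk `p` avoids
    -- both.
    obtain ⟨w, hw⟩ := h ((S.erase u).erase v) (by simp) (by simp)
      ((Finset.card_le_card ((Finset.erase_subset _ _).trans (Finset.erase_subset _ _))).trans_lt
        hlt)
    obtain ⟨a, b, ha, hb, p, hpu, hpv, hpw⟩ := exists_walk_avoiding_ends huv hna w
    have hp : ∀ e ∈ p.edges, e ∉ {e : Sym2 V | u ∈ e ∨ v ∈ e} := by
      rintro e he (hu | hv)
      · exact hpu (p.mem_support_of_mem_edges he hu)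
      · exact hpv (p.mem_support_of_mem_edges he hv)
    obtain ⟨x, hx, hxS⟩ := hS a ha b hb (p.toDeleteEdges _ hp)
    have hx' : x ∈ p.support := by
      have : (p.toDeleteEdges _ hp).support = p.support := SimpleGraph.Walk.support_transfer ..
      rwa [this] at hx
    refine hw x (hpw hx') ?_
    simp only [Finset.mem_erase]
    exact ⟨fun h => hpv (h ▸ hx'), fun h => hpu (h ▸ hx'), hxS⟩
  have paths : ∀ i, ∃ P : G.Path u v, ∀ x ∈ (P : G.Walk u v).support,
      x = u ∨ x = v ∨ x ∈ (L.walk i).support := by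
    intro i
    have h1 : G.Adj u (L.src i) := L.src_mem i
    have h2 : G.Adj v (L.tgt i) := L.tgt_mem i
    let w : G.Walk u v := .cons h1 (((L.walk i).mapLe hG₀).concat h2.symm)
    refine ⟨w.toPath, fun x hx => ?_⟩
    have := w.support_toPath_subset_support hx
    simp only [w, SimpleGraph.Walk.support_cons, SimpleGraph.Walk.support_concat, List.mem_cons,
      List.mem_append, SimpleGraph.Walk.support_mapLe_eq_support, List.not_mem_nil,
      or_false] at this
    tauto
  choose P hP using paths
  have disj : ∀ i j, i ≠ j → ∀ x, x ∈ (P i : G.Walk u v).support →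
      x ∈ (P j : G.Walk u v).support → x = u ∨ x = v := by
    intro i j hij x hi hj
    rcases hP i x hi with h | h | hi'
    · exact .inl h
    · exact .inr h
    · rcases hP j x hj with h | h | hj'
      · exact .inl h
      · exact .inr h
      · exact absurd (L.disj i j x hi' hj') hij
  refine ⟨P, fun i j hij => ?_, disj⟩
  -- Two equal paths with different indices could have no interior vertex, but `u` and `v` are not
  -- adjacent.
  by_contra hne
  obtain ⟨a, b, ha, hb, p, hpu, hpv, hpw⟩ :=
    exists_walk_avoiding_ends huv hna (P i : G.Walk u v)
  have hai := hpw p.start_mem_support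
  rcases disj i j hne a hai (hij ▸ hai) with rfl | rfl
  · exact hpu p.start_mem_support
  · exact hpv p.start_mem_support

theorem IsKConnected.exists_walk {G : SimpleGraph V} {k : ℕ} (hG : IsKConnected G k)
    {U : Finset V} (hU : U.card < k) {a b : V} (ha : a ∉ U) (hb : b ∉ U) :
    ∃ w : G.Walk a b, ∀ x ∈ w.support, x ∉ U := by
  obtain ⟨w⟩ := (hG.2 U hU).preconnected ⟨a, ha⟩ ⟨b, hb⟩
  refine ⟨w.map (SimpleGraph.Embedding.induce {v : V | v ∉ U}).toHom, fun x hx => ?_⟩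
  have hx' : x ∈ w.support.map (SimpleGraph.Embedding.induce (G := G) {v : V | v ∉ U}).toHom := by
    rw [← SimpleGraph.Walk.support_map]; exact hx
  obtain ⟨y, -, rfl⟩ := List.mem_map.1 hx'
  exact y.2

/-- **Menger's theorem** for `k`-connected graphs. -/
theorem IsKConnected.exists_paths [Finite V] {G : SimpleGraph V} {k : ℕ} (hG : IsKConnected G k)
    {u v : V} (huv : u ≠ v) :
    ∃ P : Fin k → G.Path u v, Function.Injective P ∧ ∀ i j, i ≠ j → ∀ x,
      x ∈ (P i : G.Walk u v).support → x ∈ (P j : G.Walk u v).support → x = u ∨ x = v := by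
  classical
  by_cases hadj : G.Adj u v
  · cases k with
    | zero => exact ⟨Fin.elim0, fun i => i.elim0, fun i => i.elim0⟩
    | succ k =>
    have hle : G.deleteEdges {s(u, v)} ≤ G := G.deleteEdges_le _
    -- The edge `uv` is one path; the other `k` come from `G - uv`. There a set `S` of fewer than
    -- `k` vertices is bypassed through a third vertex `z`: from `u` to `z` avoiding `v`, then from
    -- `z` to `v` avoiding `u`, so `uv` is never used.
    obtain ⟨P, -, hPd⟩ := exists_paths_of_not_adj (G := G.deleteEdges {s(u, v)}) huv
      (by simp) k (by
        intro S hu hv hS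
        have : ∃ z, z ∉ insert u (insert v S) := by
          by_contra! hall
          have h1 : (insert u (insert v S)).card = Nat.card V := by
            have := Fintype.ofFinite V
            rw [Finset.eq_univ_of_forall hall, Finset.card_univ, Nat.card_eq_fintype_card]
          have h2 := Finset.card_insert_le u (insert v S)
          have h3 := Finset.card_insert_le v S
          have := hG.1
          omega
        obtain ⟨z, hz⟩ := this
        simp only [Finset.mem_insert, not_or] at hz
        obtain ⟨p, hp⟩ := hG.exists_walk (U := insert v S) (a := u) (b := z)
          ((Finset.card_insert_le v S).trans_lt (by omega)) (by simp [huv, hu])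
          (by simp [hz.2.1, hz.2.2])
        obtain ⟨q, hq⟩ := hG.exists_walk (U := insert u S) (a := z) (b := v)
          ((Finset.card_insert_le u S).trans_lt (by omega)) (by simp [hz.1, hz.2.2])
          (by simp [huv.symm, hv])
        obtain ⟨p', hp'⟩ := exists_walk_deleteEdges (x := u) (y := v) p
          fun he => hp v (p.snd_mem_support_of_mem_edges he) (by simp)
        obtain ⟨q', hq'⟩ := exists_walk_deleteEdges (x := u) (y := v) q
          fun he => hq u (q.fst_mem_support_of_mem_edges he) (by simp)
        refine ⟨p'.append q', fun x hx hxS => ?_⟩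
        rw [SimpleGraph.Walk.mem_support_append_iff, hp', hq'] at hx
        rcases hx with hx | hx
        · exact hp x hx (by simp [hxS])
        · exact hq x hx (by simp [hxS]))
    let e : G.Path u v := SimpleGraph.Path.singleton hadj
    let P' : Fin k → G.Path u v := fun i => ⟨(P i : _).1.mapLe hle, (P i).2.mapLe hle⟩
    let Q : Fin (k + 1) → G.Path u v := Fin.cons e P'
    have he : ∀ x, x ∈ (e : G.Walk u v).support → x = u ∨ x = v := by
      intro x hx
      simpa [e, SimpleGraph.Path.singleton] using hx
    have hd : ∀ i j, i ≠ j → ∀ x, x ∈ (Q i : G.Walk u v).support →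
        x ∈ (Q j : G.Walk u v).support → x = u ∨ x = v := by
      intro i j hij x hi hj
      refine Fin.cases ?_ (fun i => ?_) i hij hi
      · intro _ hi
        exact he x hi
      · intro hij hi
        revert hij hj
        refine Fin.cases ?_ (fun j => ?_) j
        · intro hj _
          exact he x hj
        · intro hj hij
          exact hPd i j (fun h => hij (h ▸ rfl)) x (by simpa [Q, P'] using hi)
            (by simpa [Q, P'] using hj)
    have hnt : ∀ i, ∃ x ∈ (P' i : G.Walk u v).support, x ≠ u ∧ x ≠ v := by
      intro i
      obtain ⟨a, b, -, -, p, hpu, hpv, hpw⟩ := exists_walk_avoiding_ends huv (by simp) (P i).1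
      refine ⟨a, ?_, fun h => hpu (h ▸ p.start_mem_support),
        fun h => hpv (h ▸ p.start_mem_support)⟩
      simpa [P'] using hpw p.start_mem_support
    refine ⟨Q, fun i j hij => ?_, hd⟩
    by_contra hne
    have hsub : ∀ x ∈ (Q i : G.Walk u v).support, x = u ∨ x = v :=
      fun x hx => hd i j hne x hx (hij ▸ hx)
    have hone : ∀ l, (∀ x ∈ (Q l : G.Walk u v).support, x = u ∨ x = v) → l = 0 := by
      refine Fin.cases (fun _ => rfl) fun l hl => ?_
      obtain ⟨x, hx, hxu, hxv⟩ := hnt l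
      rcases hl x hx with h | h
      · exact absurd h hxu
      · exact absurd h hxv
    exact hne ((hone i hsub).trans (hone j (hij ▸ hsub)).symm)
  · exact exists_paths_of_not_adj huv hadj k fun S hu hv hS => hG.exists_walk hS hu hv

/-! ### The lower bound -/

theorem mem_colourCounts_of_isKConnected [Finite V] {G H : SimpleGraph V} {k : ℕ} (hle : H ≤ G)
    (hH : IsKConnected H k) (hpos : 0 < numEdges H) :
    numEdges G - numEdges H + 1 ∈ colourCounts G k := by
  classical
  let D := {e : G.edgeSet // e.1 ∉ H.edgeSet}
  have hsub : H.edgeSet ⊆ G.edgeSet := SimpleGraph.edgeSet_mono hle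
  have hD : Nat.card D = numEdges G - numEdges H := by
    rw [numEdges, numEdges, ← Set.ncard_sdiff hsub, ← Nat.card_coe_set_eq]
    exact Nat.card_congr
      ⟨fun e => ⟨e.1.1, e.1.2, e.2⟩, fun e => ⟨⟨e.1, e.2.1⟩, e.2.2⟩, fun _ => rfl, fun _ => rfl⟩
  let ε : D ≃ Fin (Nat.card D) := Finite.equivFin D
  let φ : G.EdgeLabeling (Fin (Nat.card D + 1)) := fun e =>
    if h : e.1 ∈ H.edgeSet then 0 else (ε ⟨e, h⟩).succ
  refine ⟨Nat.card D + 1, φ, ?_, ?_⟩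
  · intro u v huv
    obtain ⟨P, hinj, hd⟩ := hH.exists_paths huv
    refine ⟨fun i => ⟨(P i).1.mapLe hle, (P i).2.mapLe hle⟩, ?_, ?_, ?_⟩
    · intro i j hij
      apply hinj
      have := congrArg (fun Q : G.Path u v => Q.1.support) hij
      simp only [SimpleGraph.Walk.support_mapLe_eq_support] at this
      exact Subtype.ext (SimpleGraph.Walk.ext_support this)
    · intro i j hij x hi hj
      exact hd i j hij x (by simpa using hi) (by simpa using hj)
    · intro i
      refine ⟨0, fun e he => ?_⟩
      have : e ∈ H.edgeSet := (P i).1.edges_subset_edgeSet (by simpa using he)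
      simp [φ, this]
  · have hsurj : Set.range φ = Set.univ := by
      rw [Set.range_eq_univ]
      refine Fin.cases ?_ fun j => ?_
      · obtain ⟨e, he⟩ := Set.nonempty_of_ncard_ne_zero hpos.ne'
        exact ⟨⟨e, hsub he⟩, dif_pos he⟩
      · refine ⟨(ε.symm j).1, ?_⟩
        have h := (ε.symm j).2
        simp only [dif_neg h]
        rw [show (⟨(ε.symm j).1, h⟩ : D) = ε.symm j from rfl, ε.apply_symm_apply]
    rw [hsurj, Set.ncard_univ, Nat.card_eq_fintype_card, Fintype.card_fin, hD]

/-! ### Inequalities for the contribution of one colour -/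

-- The row of `u` vanishes if `f u = 0`; otherwise its nonzero terms come from the other vertices in
-- the support of `f`, and each is at most `f u`.
open Finset in
theorem sum_min_add_sum_le [DecidableEq V] (Y : Finset V) (f : V → ℕ) :
    ∑ u ∈ Y, ∑ v ∈ Y.erase u, min (f u) (f v) + ∑ u ∈ Y, f u ≤
      #{u ∈ Y | 0 < f u} * ∑ u ∈ Y, f u := by
  rw [← sum_add_distrib, mul_sum]
  refine sum_le_sum fun u hu => ?_
  rcases Nat.eq_zero_or_pos (f u) with h0 | hpos
  · simp [h0]
  · have hsub : ∑ v ∈ Y.erase u, min (f u) (f v) ≤ ∑ v ∈ {v ∈ Y | 0 < f v}.erase u, f u := by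
      rw [← sum_subset (f := fun v => min (f u) (f v))
        (erase_subset_erase u (filter_subset (fun v => 0 < f v) Y))]
      · exact sum_le_sum fun v _ => min_le_left _ _
      · intro v hv hv'
        simp only [mem_erase, mem_filter, not_and, not_lt] at hv hv'
        simp [Nat.le_zero.1 (hv' hv.1 hv.2)]
    have hmem : u ∈ {v ∈ Y | 0 < f v} := by simp [hu, hpos]
    rw [sum_const, smul_eq_mul, card_erase_of_mem hmem] at hsub
    have hcard : 0 < #{v ∈ Y | 0 < f v} := card_pos.2 ⟨u, hmem⟩
    calc _ ≤ (#{v ∈ Y | 0 < f v} - 1) * f u + f u := Nat.add_le_add_right hsub _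
      _ = _ := by
        rw [← Nat.succ_mul, Nat.succ_eq_add_one, Nat.sub_add_cancel hcard]

open Finset in
theorem card_filter_pos_le_sum (Y : Finset V) (f : V → ℕ) :
    #{u ∈ Y | 0 < f u} ≤ ∑ u ∈ Y, f u := by
  rw [card_eq_sum_ones, sum_filter]
  refine sum_le_sum fun u _ => ?_
  split_ifs with h
  · exact h
  · exact Nat.zero_le _

open Finset in
theorem sum_offDiag_le [DecidableEq V] {Y : Finset V} {m : ℕ} (hY : #Y = m + 1) {d : V → ℕ}
    {n : V → V → ℕ} (hn : ∀ u ∈ Y, ∀ v ∈ Y, u ≠ v → n u v ≤ d u) :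
    ∑ u ∈ Y, ∑ v ∈ Y.erase u, n u v ≤ m * ∑ u ∈ Y, d u := by
  rw [mul_sum]
  refine sum_le_sum fun u hu => ?_
  calc _ ≤ ∑ v ∈ Y.erase u, d u := sum_le_sum fun v hv =>
        hn u hu v (mem_of_mem_erase hv) (ne_of_mem_erase hv).symm
    _ = _ := by rw [sum_const, card_erase_of_mem hu, hY, smul_eq_mul, Nat.add_sub_cancel]

open Finset in
theorem eq_of_sum_offDiag_eq [DecidableEq V] {Y : Finset V} {m : ℕ} (hY : #Y = m + 1) {d : V → ℕ}
    {n : V → V → ℕ} (hn : ∀ u ∈ Y, ∀ v ∈ Y, u ≠ v → n u v ≤ d u)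
    (h : ∑ u ∈ Y, ∑ v ∈ Y.erase u, n u v = m * ∑ u ∈ Y, d u) :
    ∀ u ∈ Y, ∀ v ∈ Y, u ≠ v → n u v = d u := by
  have hrow : ∀ u ∈ Y, ∑ v ∈ Y.erase u, d u = m * d u := fun u hu => by
    rw [sum_const, card_erase_of_mem hu, hY, smul_eq_mul, Nat.add_sub_cancel]
  rw [mul_sum, ← sum_congr rfl hrow] at h
  have hle : ∀ u ∈ Y, ∀ v ∈ Y.erase u, n u v ≤ d u := fun u hu v hv =>
    hn u hu v (mem_of_mem_erase hv) (ne_of_mem_erase hv).symm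
  have h' := (sum_eq_sum_iff_of_le fun u hu => sum_le_sum (hle u hu)).1 h
  intro u hu v hv huv
  exact (sum_eq_sum_iff_of_le (hle u hu)).1 (h' u hu) v (mem_erase.2 ⟨huv.symm, hv⟩)

open Finset in
theorem sum_offDiag_comm [DecidableEq V] (Y : Finset V) (n : V → V → ℕ) :
    ∑ u ∈ Y, ∑ v ∈ Y.erase u, n u v = ∑ u ∈ Y, ∑ v ∈ Y.erase u, n v u := by
  apply sum_comm'
  intro u v
  simp only [mem_erase]
  tauto

open Finset in
/-- The contribution of a colour class with degrees `d` and pair multiplicities `n` when the class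
does not both span `Y` and have at least `2 * #Y` edges. -/
theorem sum_offDiag_add_le [DecidableEq V] {Y : Finset V} {m : ℕ} (hY : #Y = m + 1) {d : V → ℕ}
    {n : V → V → ℕ} (hn₁ : ∀ u ∈ Y, ∀ v ∈ Y, u ≠ v → n u v ≤ d u)
    (hn₂ : ∀ u ∈ Y, ∀ v ∈ Y, u ≠ v → n u v ≤ d v) (hpos : 0 < ∑ u ∈ Y, d u)
    (hstar : (∀ y ∈ Y, d y = 1) → ∃ F : V → V, (∃ u ∈ Y, ∃ v ∈ Y, F u ≠ F v) ∧
      ∀ u ∈ Y, ∀ v ∈ Y, u ≠ v → n u v ≠ 0 → F u = F v)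
    (hgood : (∀ y ∈ Y, 0 < d y) → ∑ u ∈ Y, d u < 2 * #Y) :
    ∑ u ∈ Y, ∑ v ∈ Y.erase u, n u v + m ≤ m * ∑ u ∈ Y, d u := by
  by_cases hspan : ∀ y ∈ Y, 0 < d y
  · have hlt := hgood hspan
    by_cases hone : ∀ y ∈ Y, d y = 1
    · obtain ⟨F, ⟨u₀, hu₀, v₀, hv₀, hF⟩, hFn⟩ := hstar hone
      -- Some `w` has another `F`-value than `u`, so each row of ones loses an entry.
      have hrow : ∀ u ∈ Y, ∑ v ∈ Y.erase u, n u v + 1 ≤ m := by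
        intro u hu
        obtain ⟨w, hw, hwu⟩ : ∃ w ∈ Y, F u ≠ F w := by
          by_cases h : F u = F u₀
          · exact ⟨v₀, hv₀, h ▸ hF⟩
          · exact ⟨u₀, hu₀, h⟩
        have hne : w ≠ u := fun h => hwu (h ▸ rfl)
        have hw' : w ∈ Y.erase u := mem_erase.2 ⟨hne, hw⟩
        have h0 : n u w = 0 := by
          by_contra h
          exact hwu (hFn u hu w hw hne.symm h)
        rw [← add_sum_erase _ _ hw', h0, Nat.zero_add]
        calc _ ≤ ∑ v ∈ (Y.erase u).erase w, 1 + 1 := by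
              refine Nat.add_le_add_right (sum_le_sum fun v hv => ?_) 1
              have hv' := mem_of_mem_erase hv
              exact (hn₁ u hu v (mem_of_mem_erase hv') (ne_of_mem_erase hv').symm).trans
                (hone u hu).le
          _ = m := by
              have hm : 0 < #(Y.erase u) := card_pos.2 ⟨w, hw'⟩
              rw [card_erase_of_mem hu] at hm
              rw [sum_const, card_erase_of_mem hw', card_erase_of_mem hu, smul_eq_mul, mul_one]
              omega
      have h1 := sum_le_sum hrow
      rw [sum_add_distrib, sum_const, sum_const, smul_eq_mul, smul_eq_mul, hY] at h1
      rw [sum_congr rfl hone, sum_const, smul_eq_mul, hY]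
      nlinarith
    · push Not at hone
      obtain ⟨y₀, hy₀, hdy₀⟩ := hone
      -- With `r = ∑ f`, at most `r` vertices have `f > 0`, so the pair sum is at most `m (m + 1) +
      -- r (r - 1)`. The bound `m (m + 1 + r) - m` then amounts to `r (r - 1) ≤ m (r - 1)`.
      obtain ⟨f, hf⟩ : ∃ f : V → ℕ, ∀ y ∈ Y, d y = f y + 1 :=
        ⟨fun y => d y - 1, fun y hy => (Nat.sub_add_cancel (hspan y hy)).symm⟩
      have hA := sum_min_add_sum_le Y f
      have hB := card_filter_pos_le_sum Y f
      have hsum : ∑ u ∈ Y, d u = ∑ u ∈ Y, f u + (m + 1) := by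
        rw [sum_congr rfl hf, sum_add_distrib, sum_const, smul_eq_mul, mul_one, hY]
      have hr : 1 ≤ ∑ u ∈ Y, f u := by
        have h1 : f y₀ ≤ ∑ u ∈ Y, f u := single_le_sum (fun _ _ => Nat.zero_le _) hy₀
        have := hf y₀ hy₀
        omega
      have hW : ∑ u ∈ Y, ∑ v ∈ Y.erase u, n u v ≤
          ∑ u ∈ Y, ∑ v ∈ Y.erase u, min (f u) (f v) + (m + 1) * m := by
        have : (m + 1) * m = ∑ u ∈ Y, ∑ v ∈ Y.erase u, 1 := by
          rw [← hY, ← smul_eq_mul, ← sum_const]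
          refine sum_congr rfl fun u hu => ?_
          rw [sum_const, card_erase_of_mem hu, hY, smul_eq_mul, mul_one, Nat.add_sub_cancel]
        rw [this, ← sum_add_distrib]
        refine sum_le_sum fun u hu => ?_
        rw [← sum_add_distrib]
        refine sum_le_sum fun v hv => ?_
        have hvY := mem_of_mem_erase hv
        have h1 := hn₁ u hu v hvY (ne_of_mem_erase hv).symm
        have h2 := hn₂ u hu v hvY (ne_of_mem_erase hv).symm
        have h3 := hf u hu
        have h4 := hf v hvY
        omega
      -- This is what the threshold `2 * #Y` is for.
      have hrm : ∑ u ∈ Y, f u ≤ m := by omega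
      rw [hsum]
      generalize ∑ u ∈ Y, f u = r at *
      have h5 := hA.trans (Nat.mul_le_mul_right r hB)
      obtain ⟨q, rfl⟩ := Nat.exists_eq_add_of_le' hr
      have h6 := Nat.mul_le_mul_right q hrm
      nlinarith
  -- With `b ≤ m` vertices of positive degree and `e` edges, the pair sum is at most `(b - 1) e`;
  -- the claim follows from `m ≤ (m - b + 1) b` and `b ≤ e`.
  · have hA := sum_min_add_sum_le Y d
    have hB := card_filter_pos_le_sum Y d
    have hb : #{u ∈ Y | 0 < d u} ≤ m := by
      push Not at hspan
      obtain ⟨y, hy, hy0⟩ := hspan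
      have : {u ∈ Y | 0 < d u} ⊂ Y :=
        filter_ssubset.2 ⟨y, hy, by omega⟩
      have := card_lt_card this
      omega
    have hb1 : 1 ≤ #{u ∈ Y | 0 < d u} := by
      by_contra h
      have : #{u ∈ Y | 0 < d u} = 0 := by omega
      rw [this] at hA
      omega
    have hW : ∑ u ∈ Y, ∑ v ∈ Y.erase u, n u v ≤
        ∑ u ∈ Y, ∑ v ∈ Y.erase u, min (d u) (d v) :=
      sum_le_sum fun u hu => sum_le_sum fun v hv =>
        le_min (hn₁ u hu v (mem_of_mem_erase hv) (ne_of_mem_erase hv).symm)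
          (hn₂ u hu v (mem_of_mem_erase hv) (ne_of_mem_erase hv).symm)
    generalize ∑ u ∈ Y, d u = e at *
    generalize #{u ∈ Y | 0 < d u} = b at *
    obtain ⟨j, rfl⟩ := Nat.exists_eq_add_of_le' hb1
    obtain ⟨l, rfl⟩ := Nat.exists_eq_add_of_le hb
    obtain ⟨i, rfl⟩ := Nat.exists_eq_add_of_le hB
    have h1 : ∑ u ∈ Y, ∑ v ∈ Y.erase u, n u v ≤ j * (j + 1 + i) := by nlinarith
    nlinarith [Nat.zero_le (l * j), Nat.zero_le (l * i)]

/-! ### Colour classes and the paths they carry -/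

theorem mem_edgeSet_labelGraph {G : SimpleGraph V} {C : Type*} {φ : G.EdgeLabeling C} {c : C}
    {e : Sym2 V} : e ∈ (φ.labelGraph c).edgeSet ↔ ∃ he : e ∈ G.edgeSet, φ ⟨e, he⟩ = c := by
  induction e using Sym2.ind with
  | _ x y =>
    rw [SimpleGraph.mem_edgeSet]
    exact SimpleGraph.EdgeLabeling.labelGraph_adj x y

theorem labelGraph_adj_unique {G : SimpleGraph V} {C : Type*} {φ : G.EdgeLabeling C} {c c' : C}
    {x y : V} (h : (φ.labelGraph c).Adj x y) (h' : (φ.labelGraph c').Adj x y) : c = c' := by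
  obtain ⟨_, rfl⟩ := (SimpleGraph.EdgeLabeling.labelGraph_adj x y).1 h
  obtain ⟨_, rfl⟩ := (SimpleGraph.EdgeLabeling.labelGraph_adj x y).1 h'
  rfl

/-- The first and last steps of the `k` monochromatic paths between two nonadjacent vertices. -/
theorem IsMonoKConnected.exists_path_ends {G : SimpleGraph V} {C : Type*} {φ : G.EdgeLabeling C}
    {k : ℕ} (hφ : IsMonoKConnected φ k) {u v : V} (huv : u ≠ v) (hna : ¬ G.Adj u v) :
    ∃ (col : Fin k → C) (a b : Fin k → V), (∀ i j, a i = a j → i = j) ∧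
      (∀ i j, b i = b j → i = j) ∧ (∀ i j, a i = b j → i = j) ∧
      ∀ i, (φ.labelGraph (col i)).Adj u (a i) ∧ (φ.labelGraph (col i)).Adj v (b i) ∧
        (φ.labelGraph (col i)).Reachable u v := by
  obtain ⟨P, -, hd, hm⟩ := hφ u v huv
  choose col hcol using hm
  have key : ∀ i, ∃ a b, (φ.labelGraph (col i)).Adj u a ∧ (φ.labelGraph (col i)).Adj v b ∧
      (φ.labelGraph (col i)).Reachable u v ∧ a ∈ (P i : G.Walk u v).support ∧
      b ∈ (P i : G.Walk u v).support := by
    intro i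
    let q : (φ.labelGraph (col i)).Walk u v := (P i).1.transfer _ fun e he =>
      mem_edgeSet_labelGraph.2 ⟨(P i).1.edges_subset_edgeSet he, hcol i e he⟩
    have hq : q.support = (P i : G.Walk u v).support := SimpleGraph.Walk.support_transfer ..
    obtain ⟨a, b, ha, hb, p, -, -, hp⟩ := exists_walk_avoiding_ends huv
      (fun h => hna (SimpleGraph.EdgeLabeling.labelGraph_le φ h)) q
    exact ⟨a, b, ha, hb, q.reachable, hq ▸ hp p.start_mem_support, hq ▸ hp p.end_mem_support⟩
  choose a b ha hb hr has hbs using key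
  have hau : ∀ i, a i ≠ u ∧ a i ≠ v := fun i => ⟨(ha i).ne.symm, fun h =>
    hna (SimpleGraph.EdgeLabeling.labelGraph_le φ (h ▸ ha i))⟩
  have hbu : ∀ i, b i ≠ u ∧ b i ≠ v := fun i => ⟨fun h =>
    hna (SimpleGraph.EdgeLabeling.labelGraph_le φ (h ▸ hb i)).symm, (hb i).ne.symm⟩
  have sep : ∀ i j x, x ≠ u ∧ x ≠ v → x ∈ (P i : G.Walk u v).support →
      x ∈ (P j : G.Walk u v).support → i = j := by
    intro i j x hx hi hj
    by_contra hij
    exact (hd i j hij x hi hj).elim hx.1 hx.2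
  exact ⟨col, a, b, fun i j h => sep i j _ (hau i) (has i) (h ▸ has j),
    fun i j h => sep i j _ (hbu i) (hbs i) (h ▸ hbs j),
    fun i j h => sep i j _ (hau i) (has i) (h ▸ hbs j), fun i => ⟨ha i, hb i, hr i⟩⟩

/-- The number of neighbours of `v` along edges of colour `c`. -/
noncomputable def colourDegree {G : SimpleGraph V} {C : Type*} (φ : G.EdgeLabeling C) (c : C)
    (v : V) : ℕ := ((φ.labelGraph c).neighborSet v).ncard

-- `n c` counts the chosen paths of colour `c`. They leave `u` through different neighbours, whence
-- the degree bounds. When a bound is attained, every `c`-neighbour is used; a vertex `x` as in the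
-- last clause would lie inside two paths of different colours.
open Finset in
theorem IsMonoKConnected.exists_multiplicity [Finite V] {G : SimpleGraph V} {C : Type*}
    {φ : G.EdgeLabeling C} {k : ℕ} (hφ : IsMonoKConnected φ k) {u v : V} (huv : u ≠ v)
    (hna : ¬ G.Adj u v) :
    ∃ n : C → ℕ, (∀ R : Finset C, (∀ e, φ e ∈ R) → ∑ c ∈ R, n c = k) ∧
      (∀ c, n c ≤ colourDegree φ c u) ∧ (∀ c, n c ≤ colourDegree φ c v) ∧
      (∀ c, n c ≠ 0 → (φ.labelGraph c).Reachable u v) ∧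
      ∀ c c' x, c ≠ c' → n c = colourDegree φ c u → n c' = colourDegree φ c' v →
        (φ.labelGraph c).Adj u x → ¬ (φ.labelGraph c').Adj v x := by
  classical
  obtain ⟨col, a, b, ha, hb, hab, h⟩ := hφ.exists_path_ends huv hna
  have hcard : ∀ (f : Fin k → V) (hf : ∀ i j, f i = f j → i = j) c,
      ((({i | col i = c} : Finset (Fin k)).image f : Finset V) : Set V).ncard =
        #{i | col i = c} := by
    intro f hf c
    rw [Set.ncard_coe_finset, card_image_of_injective _ fun i j => hf i j]
  have hsub : ∀ (f : Fin k → V) (w : V) (_ : ∀ i, (φ.labelGraph (col i)).Adj w (f i)) c,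
      ((({i | col i = c} : Finset (Fin k)).image f : Finset V) : Set V) ⊆
        (φ.labelGraph c).neighborSet w := by
    intro f w hw c x hx
    simp only [coe_image, coe_filter, mem_univ, true_and, Set.mem_image, Set.mem_ofPred_eq] at hx
    obtain ⟨i, rfl, rfl⟩ := hx
    exact hw i
  have hex : ∀ (f : Fin k → V) (hf : ∀ i j, f i = f j → i = j) (w : V)
      (_ : ∀ i, (φ.labelGraph (col i)).Adj w (f i)) c x, #{i | col i = c} = colourDegree φ c w →
      (φ.labelGraph c).Adj w x → ∃ i, col i = c ∧ f i = x := by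
    intro f hf w hw c x hc hx
    have heq := Set.eq_of_subset_of_ncard_le (hsub f w hw c) (by rw [hcard f hf, hc]; rfl)
    have hx' : x ∈ (φ.labelGraph c).neighborSet w := hx
    rw [← heq] at hx'
    simpa using hx'
  refine ⟨fun c => #{i | col i = c}, ?_, ?_, ?_, ?_, ?_⟩
  · intro R hR
    have hmem : ∀ i ∈ (univ : Finset (Fin k)), col i ∈ R := by
      intro i _
      obtain ⟨_, he⟩ := (SimpleGraph.EdgeLabeling.labelGraph_adj _ _).1 (h i).1
      exact he ▸ hR _
    rw [← card_eq_sum_card_fiberwise hmem, card_univ, Fintype.card_fin]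
  · intro c
    beta_reduce
    rw [← hcard a ha]
    exact Set.ncard_le_ncard (hsub a u (fun i => (h i).1) c)
  · intro c
    beta_reduce
    rw [← hcard b hb]
    exact Set.ncard_le_ncard (hsub b v (fun i => (h i).2.1) c)
  · intro c hc
    obtain ⟨i, hi⟩ := card_pos.1 (Nat.pos_of_ne_zero hc)
    simp only [mem_filter, mem_univ, true_and] at hi
    exact hi ▸ (h i).2.2
  · intro c c' x hcc hc hc' hx hx'
    obtain ⟨i, hi, hix⟩ := hex a ha u (fun i => (h i).1) c x hc hx
    obtain ⟨j, hj, hjx⟩ := hex b hb v (fun i => (h i).2.1) c' x hc' hx'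
    apply hcc
    rw [← hi, ← hj, hab i j (hix.trans hjx.symm)]

theorem eq_of_reachable {G : SimpleGraph V} {α : Type*} {F : V → α}
    (hF : ∀ x y, G.Adj x y → F x = F y) {u v : V} (h : G.Reachable u v) : F u = F v := by
  obtain ⟨w⟩ := h
  induction w with
  | nil => rfl
  | cons hadj _ ih => exact (hF _ _ hadj).trans ih

theorem not_adj_of_mem {G : SimpleGraph V} {X Y : Set V} (hbip : G.IsBipartiteWith X Y) {u v : V}
    (hu : u ∈ Y) (hv : v ∈ Y) : ¬ G.Adj u v := fun h => by
  rcases hbip.mem_of_adj h with ⟨h, -⟩ | ⟨-, h⟩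
  · exact Set.disjoint_left.1 hbip.disjoint h hu
  · exact Set.disjoint_left.1 hbip.disjoint h hv

theorem numEdges_labelGraph [Finite V] {G : SimpleGraph V} {C : Type*}
    (φ : G.EdgeLabeling C) {X Y : Finset V} (hbip : G.IsBipartiteWith (X : Set V) Y) (c : C) :
    numEdges (φ.labelGraph c) = ∑ y ∈ Y, colourDegree φ c y := by
  classical
  have := Fintype.ofFinite V
  have hb : (φ.labelGraph c).IsBipartiteWith (X : Set V) Y :=
    ⟨hbip.disjoint, fun v w h => hbip.mem_of_adj (SimpleGraph.EdgeLabeling.labelGraph_le φ h)⟩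
  have h := SimpleGraph.isBipartiteWith_sum_degrees_eq_card_edges' hb
  rw [numEdges, ← SimpleGraph.coe_edgeFinset, Set.ncard_coe_finset, ← h]
  refine Finset.sum_congr rfl fun y _ => ?_
  rw [colourDegree, ← SimpleGraph.card_neighborFinset_eq_degree, ← Set.ncard_coe_finset,
    SimpleGraph.coe_neighborFinset]

open Finset in
theorem sum_numEdges_labelGraph [Finite V] {G : SimpleGraph V} {C : Type*}
    (φ : G.EdgeLabeling C) {R : Finset C} (hR : ∀ e, φ e ∈ R) :
    ∑ c ∈ R, numEdges (φ.labelGraph c) = numEdges G := by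
  classical
  have := Fintype.ofFinite V
  rw [numEdges, ← Nat.card_coe_set_eq, Nat.card_eq_fintype_card, ← card_univ,
    card_eq_sum_card_fiberwise (f := φ) (t := R) fun e _ => hR e]
  refine sum_congr rfl fun c _ => ?_
  rw [numEdges, ← card_map (Function.Embedding.subtype _), ← Set.ncard_coe_finset]
  congr 1
  ext e
  rw [mem_edgeSet_labelGraph]
  simp

/-- A colour class in which every vertex of `Y` has degree one does not link all pairs in `Y`. -/
theorem IsMonoKConnected.exists_not_constant [Finite V] {G : SimpleGraph V} {C : Type*}
    {φ : G.EdgeLabeling C} {k : ℕ} (hφ : IsMonoKConnected φ k) (hk : 0 < k) {X Y : Set V}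
    (hbip : G.IsBipartiteWith X Y) (hX : X.Nontrivial) (hY : Y.Nonempty) {c : C}
    (hc : ∀ y ∈ Y, colourDegree φ c y = 1) :
    ∃ F : V → V, (∃ u ∈ Y, ∃ v ∈ Y, F u ≠ F v) ∧
      ∀ u v, (φ.labelGraph c).Reachable u v → F u = F v := by
  classical
  have : ∀ y, ∃ g, y ∈ Y → (φ.labelGraph c).neighborSet y = {g} := by
    intro y
    by_cases hy : y ∈ Y
    · obtain ⟨g, hg⟩ := Set.ncard_eq_one.1 (hc y hy)
      exact ⟨g, fun _ => hg⟩
    · exact ⟨y, fun h => absurd h hy⟩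
  choose g hg using this
  have hgadj : ∀ y ∈ Y, (φ.labelGraph c).Adj y (g y) := fun y hy => by
    have : g y ∈ (φ.labelGraph c).neighborSet y := by rw [hg y hy]; rfl
    exact this
  have hguniq : ∀ y ∈ Y, ∀ x, (φ.labelGraph c).Adj y x → x = g y := fun y hy x hx => by
    have : x ∈ (φ.labelGraph c).neighborSet y := hx
    rwa [hg y hy] at this
  -- Sending each `y` to its only `c`-neighbour and fixing `X` gives a map constant on the
  -- components of the class.
  let F : V → V := fun v => if v ∈ Y then g v else v
  have hFY : ∀ y ∈ Y, F y = g y := fun y hy => if_pos hy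
  have hFX : ∀ x ∈ X, F x = x := fun x hx => if_neg (Set.disjoint_left.1 hbip.disjoint hx)
  have hF : ∀ x y, (φ.labelGraph c).Adj x y → F x = F y := by
    intro x y h
    rcases hbip.mem_of_adj (SimpleGraph.EdgeLabeling.labelGraph_le φ h) with ⟨hx, hy⟩ | ⟨hx, hy⟩
    · rw [hFX x hx, hFY y hy, ← hguniq y hy x h.symm]
    · rw [hFX y hy, hFY x hx, ← hguniq x hx y h]
  refine ⟨F, ?_, fun u v h => eq_of_reachable hF h⟩
  by_contra! hconst
  obtain ⟨y₀, hy₀⟩ := hY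
  have hall : ∀ y ∈ Y, (φ.labelGraph c).Adj y (g y₀) := fun y hy => by
    have := hconst y hy y₀ hy₀
    rw [hFY y hy, hFY y₀ hy₀] at this
    exact this ▸ hgadj y hy
  have hmemX : ∀ y ∈ Y, ∀ x, G.Adj y x → x ∈ X := fun y hy x h =>
    (hbip.mem_of_adj h).elim (fun h' => absurd hy (Set.disjoint_left.1 hbip.disjoint h'.1))
      fun h' => h'.2
  have hx₀ := hmemX y₀ hy₀ _ (SimpleGraph.EdgeLabeling.labelGraph_le φ (hgadj y₀ hy₀))
  -- If `F` is constant on `Y`, the class is a star at `g y₀` using all edges from there to `Y`. A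
  -- monochromatic path from the centre to another `x ∈ X` starts with colour `c` and cannot leave
  -- the star.
  obtain ⟨x, hx, hne⟩ := hX.exists_ne (g y₀)
  obtain ⟨col, a, b, -, -, -, h⟩ := hφ.exists_path_ends hne.symm
    (not_adj_of_mem hbip.symm hx₀ hx)
  obtain ⟨h1, -, h2⟩ := h ⟨0, hk⟩
  have haY : a ⟨0, hk⟩ ∈ Y :=
    (hbip.mem_of_adj (SimpleGraph.EdgeLabeling.labelGraph_le φ h1)).elim (fun h' => h'.2)
      fun h' => absurd h'.1 (Set.disjoint_left.1 hbip.disjoint hx₀)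
  rw [labelGraph_adj_unique h1 (hall _ haY).symm] at h2
  have := eq_of_reachable hF h2
  rw [hFX _ hx₀, hFX _ hx] at this
  exact hne this.symm

/-! ### Double counting and the upper bound -/

/-- The colours whose class spans `Y` and has at least `2 * #Y` edges. -/
def IsLarge {G : SimpleGraph V} {C : Type*} (φ : G.EdgeLabeling C) (Y : Finset V) (c : C) : Prop :=
  (∀ y ∈ Y, 0 < colourDegree φ c y) ∧ 2 * Y.card ≤ numEdges (φ.labelGraph c)

-- Summing the contributions `W c` over all colours counts `k` paths per ordered pair. In case of
-- equality each large colour attains its bound `m e_c`, so its multiplicities equal its degrees and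
-- the exclusion in `exists_multiplicity` applies.
open Finset in
theorem IsMonoKConnected.side_bound [Finite V] {G : SimpleGraph V} {C : Type*}
    {φ : G.EdgeLabeling C} {k m : ℕ} (hφ : IsMonoKConnected φ k) (hk : 0 < k) {X Y : Finset V}
    (hbip : G.IsBipartiteWith (X : Set V) Y) (hX : 2 ≤ #X) (hY : #Y = m + 1) (hm : 0 < m)
    {R B : Finset C} (hR : ∀ e, φ e ∈ R) (hpos : ∀ c ∈ R, 0 < numEdges (φ.labelGraph c))
    (hB : ∀ c, c ∈ B ↔ c ∈ R ∧ IsLarge φ Y c) :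
    k * (m + 1) ≤ ∑ c ∈ R, (numEdges (φ.labelGraph c) - 1) + #B ∧
    (k * (m + 1) = ∑ c ∈ R, (numEdges (φ.labelGraph c) - 1) + #B →
      ∀ c ∈ B, ∀ c' ∈ B, c ≠ c' → ∀ x, ∀ u ∈ Y, ∀ v ∈ Y,
        (φ.labelGraph c).Adj u x → ¬ (φ.labelGraph c').Adj v x) := by
  classical
  have hn : ∀ u v, ∃ n : C → ℕ, u ∈ Y → v ∈ Y → u ≠ v →
      (∀ R : Finset C, (∀ e, φ e ∈ R) → ∑ c ∈ R, n c = k) ∧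
      (∀ c, n c ≤ colourDegree φ c u) ∧ (∀ c, n c ≤ colourDegree φ c v) ∧
      (∀ c, n c ≠ 0 → (φ.labelGraph c).Reachable u v) ∧
      ∀ c c' x, c ≠ c' → n c = colourDegree φ c u → n c' = colourDegree φ c' v →
        (φ.labelGraph c).Adj u x → ¬ (φ.labelGraph c').Adj v x := by
    intro u v
    by_cases h : u ∈ Y ∧ v ∈ Y ∧ u ≠ v
    · obtain ⟨n, hn⟩ := hφ.exists_multiplicity h.2.2 (not_adj_of_mem hbip h.1 h.2.1)
      exact ⟨n, fun _ _ _ => hn⟩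
    · exact ⟨0, fun h1 h2 h3 => absurd ⟨h1, h2, h3⟩ h⟩
  choose n hn using hn
  have hn₁ : ∀ c, ∀ u ∈ Y, ∀ v ∈ Y, u ≠ v → n u v c ≤ colourDegree φ c u :=
    fun c u hu v hv huv => (hn u v hu hv huv).2.1 c
  have hn₂ : ∀ c, ∀ u ∈ Y, ∀ v ∈ Y, u ≠ v → n u v c ≤ colourDegree φ c v :=
    fun c u hu v hv huv => (hn u v hu hv huv).2.2.1 c
  have hnum := numEdges_labelGraph φ hbip
  let W : C → ℕ := fun c => ∑ u ∈ Y, ∑ v ∈ Y.erase u, n u v c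
  let U : C → ℕ := fun c => m * (numEdges (φ.labelGraph c) - 1) + if c ∈ B then m else 0
  have hU : ∀ c ∈ B, U c = m * numEdges (φ.labelGraph c) := by
    intro c hc
    have := hpos c ((hB c).1 hc).1
    simp only [U, if_pos hc]
    rw [← Nat.mul_succ, Nat.succ_eq_add_one, Nat.sub_add_cancel this]
  have hWU : ∀ c ∈ R, W c ≤ U c := by
    intro c hc
    by_cases hcB : c ∈ B
    · rw [hU c hcB, hnum]
      exact sum_offDiag_le hY (hn₁ c)
    · have h := sum_offDiag_add_le hY (hn₁ c) (hn₂ c) (hnum c ▸ hpos c hc) ?_ ?_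
      · simp only [U, if_neg hcB, add_zero]
        rw [hnum, Nat.mul_sub, mul_one]
        exact Nat.le_sub_of_add_le h
      · intro hone
        obtain ⟨F, hF, hF'⟩ := hφ.exists_not_constant hk hbip
          (Finset.one_lt_card_iff_nontrivial.1 hX) (card_pos.1 (by omega) : Y.Nonempty) hone
        exact ⟨F, hF, fun u hu v hv huv h =>
          hF' u v ((hn u v hu hv huv).2.2.2.1 c h)⟩
      · intro hspan
        by_contra! hlt
        exact hcB ((hB c).2 ⟨hc, hspan, hnum c ▸ hlt⟩)
  have hWsum : ∑ c ∈ R, W c = m * (k * (m + 1)) := by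
    have h1 : ∑ c ∈ R, W c = ∑ u ∈ Y, ∑ v ∈ Y.erase u, k := by
      rw [sum_comm]
      refine sum_congr rfl fun u hu => ?_
      rw [sum_comm]
      refine sum_congr rfl fun v hv => ?_
      exact (hn u v hu (mem_of_mem_erase hv) (ne_of_mem_erase hv).symm).1 R hR
    have h2 : ∀ u ∈ Y, ∑ v ∈ Y.erase u, k = m * k := fun u hu => by
      rw [sum_const, card_erase_of_mem hu, hY, smul_eq_mul, Nat.add_sub_cancel]
    rw [h1, sum_congr rfl h2, sum_const, hY, smul_eq_mul]
    ring
  have hUsum : ∑ c ∈ R, U c = m * (∑ c ∈ R, (numEdges (φ.labelGraph c) - 1) + #B) := by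
    have hBR : R.filter (· ∈ B) = B := by
      ext c
      simp only [mem_filter, hB]
      tauto
    rw [sum_add_distrib, ← mul_sum, ← sum_filter, hBR, sum_const, smul_eq_mul]
    ring
  refine ⟨?_, ?_⟩
  · have := sum_le_sum hWU
    rw [hWsum, hUsum] at this
    exact Nat.le_of_mul_le_mul_left this hm
  · intro heq c hc c' hc' hcc x u hu v hv hux hvx
    have htot : ∑ c ∈ R, W c = ∑ c ∈ R, U c := by rw [hWsum, hUsum, heq]
    have htight := (sum_eq_sum_iff_of_le hWU).1 htot
    have h1 : ∀ c ∈ B, W c = m * ∑ y ∈ Y, colourDegree φ c y := fun c hc => by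
      rw [htight c ((hB c).1 hc).1, hU c hc, hnum]
    have huv : u ≠ v := by
      rintro rfl
      exact hcc (labelGraph_adj_unique hux hvx)
    refine (hn u v hu hv huv).2.2.2.2 c c' x hcc ?_ ?_ hux hvx
    · exact eq_of_sum_offDiag_eq hY (hn₁ c) (h1 c hc) u hu v hv huv
    -- The degree at the second vertex is needed here, hence the transposed sum.
    · refine eq_of_sum_offDiag_eq (n := fun u v => n v u c') hY
        (fun u hu v hv huv => hn₂ c' v hv u hu huv.symm) ?_ v hv u hu huv.symm
      rw [← h1 c' hc']
      exact sum_offDiag_comm Y _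

theorem exists_adj_of_colourDegree_pos {G : SimpleGraph V} {C : Type*} {φ : G.EdgeLabeling C}
    {c : C} {v : V} (h : 0 < colourDegree φ c v) : ∃ w, (φ.labelGraph c).Adj v w :=
  Set.nonempty_of_ncard_ne_zero h.ne'

open Finset in
theorem card_mul_le_sum_numEdges {G : SimpleGraph V} {C : Type*} {φ : G.EdgeLabeling C}
    {R B : Finset C} (hBR : B ⊆ R) {l : ℕ} (hB : ∀ c ∈ B, l ≤ numEdges (φ.labelGraph c)) :
    #B * (l - 1) ≤ ∑ c ∈ R, (numEdges (φ.labelGraph c) - 1) :=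
  calc #B * (l - 1) = ∑ c ∈ B, (l - 1) := by rw [sum_const, smul_eq_mul]
    _ ≤ ∑ c ∈ B, (numEdges (φ.labelGraph c) - 1) :=
      sum_le_sum fun c hc => Nat.sub_le_sub_right (hB c hc) 1
    _ ≤ _ := sum_le_sum_of_subset hBR

open Finset in
theorem IsMonoKConnected.mul_le_sum [Finite V] {G : SimpleGraph V} {C : Type*}
    {φ : G.EdgeLabeling C} {k : ℕ} (hφ : IsMonoKConnected φ k) (hk : 2 ≤ k) {X Y : Finset V}
    (hbip : G.IsBipartiteWith (X : Set V) Y) (hkX : k ≤ #X) (hXY : #X ≤ #Y)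
    (hk' : k ≤ 3 ∨ (#X = #Y ∧ k ≤ 5))
    {R : Finset C} (hR : ∀ e, φ e ∈ R) (hpos : ∀ c ∈ R, 0 < numEdges (φ.labelGraph c)) :
    k * #Y ≤ ∑ c ∈ R, (numEdges (φ.labelGraph c) - 1) + 1 := by
  classical
  obtain ⟨m, hm⟩ : ∃ m, #Y = m + 1 := ⟨#Y - 1, by omega⟩
  set S := ∑ c ∈ R, (numEdges (φ.labelGraph c) - 1) with hS
  let L := R.filter fun c => 2 * #Y ≤ numEdges (φ.labelGraph c)
  let BY := R.filter (IsLarge φ Y)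
  let BX := R.filter (IsLarge φ X)
  have hLS : #L * (2 * #Y - 1) ≤ S :=
    card_mul_le_sum_numEdges (filter_subset _ _) fun c hc => (mem_filter.1 hc).2
  have hBYL : BY ⊆ L := fun c hc => by
    obtain ⟨h1, h2⟩ := mem_filter.1 hc
    exact mem_filter.2 ⟨h1, h2.2⟩
  obtain ⟨hY, hYtight⟩ := hφ.side_bound (by omega) hbip (by omega) hm (by omega) hR hpos
    (B := BY) fun c => mem_filter
  rw [← hS, ← hm] at hY hYtight
  by_cases hBY : #BY ≤ 1
  · omega
  have hL2 : 2 ≤ #L := (Nat.lt_of_not_le hBY).trans_le (card_le_card hBYL)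
  by_cases hk3 : k ≤ 3
  -- Two classes give `2 (2t - 1) ≥ 3t - 1`.
  · have h1 := Nat.mul_le_mul_right (2 * #Y - 1) hL2
    have h2 := Nat.mul_le_mul_right #Y hk3
    omega
  obtain ⟨hst, hk5⟩ := hk'.resolve_left hk3
  have h5 := Nat.mul_le_mul_right #Y hk5
  by_cases hL3 : 3 ≤ #L
  -- Three classes give `3 (2t - 1) ≥ 5t - 1`, as `t ≥ 2`.
  · have h1 := Nat.mul_le_mul_right (2 * #Y - 1) hL3
    omega
  obtain ⟨hX, -⟩ := hφ.side_bound (by omega) hbip.symm (by omega) (hst.trans hm) (by omega) hR hpos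
    (B := BX) fun c => mem_filter
  rw [← hS, ← hm] at hX
  by_cases hBX : #BX ≤ 1
  · omega
  have hBXL : BX ⊆ L := fun c hc => by
    obtain ⟨h1, h2⟩ := mem_filter.1 hc
    exact mem_filter.2 ⟨h1, hst ▸ h2.2⟩
  have hBXeq : BX = L := eq_of_subset_of_card_le hBXL (by omega)
  have hBYeq : BY = L := eq_of_subset_of_card_le hBYL (by omega)
  have hcard : #BY = 2 := by rw [hBYeq]; omega
  by_contra! hlt
  obtain ⟨c, hc, c', hc', hcc⟩ := one_lt_card.1 (show 1 < #BY by omega)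
  obtain ⟨x, hx⟩ : X.Nonempty := card_pos.1 (by omega)
  -- Both colours also span `X`, so each has an edge at `x`; this is what tightness on the `Y` side
  -- forbids.
  have hnb : ∀ c ∈ BY, ∃ u ∈ Y, (φ.labelGraph c).Adj u x := by
    intro c hc
    rw [hBYeq, ← hBXeq] at hc
    obtain ⟨u, hu⟩ := exists_adj_of_colourDegree_pos ((mem_filter.1 hc).2.1 x hx)
    refine ⟨u, ?_, hu.symm⟩
    rcases hbip.mem_of_adj (SimpleGraph.EdgeLabeling.labelGraph_le φ hu) with ⟨-, h⟩ | ⟨h, -⟩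
    · exact h
    · exact absurd h (Set.disjoint_left.1 hbip.disjoint hx)
  obtain ⟨u, hu, hux⟩ := hnb c hc
  obtain ⟨v, hv, hvx⟩ := hnb c' hc'
  exact hYtight (by omega) c hc c' hc' hcc x u hu v hv hux hvx

theorem IsMonoKConnected.ncard_range_add_le [Finite V] {G : SimpleGraph V} {r : ℕ}
    {φ : G.EdgeLabeling (Fin r)} {k : ℕ} (hφ : IsMonoKConnected φ k) (hk : 2 ≤ k)
    {X Y : Finset V} (hbip : G.IsBipartiteWith (X : Set V) Y) (hkX : k ≤ X.card)
    (hXY : X.card ≤ Y.card) (hk' : k ≤ 3 ∨ (X.card = Y.card ∧ k ≤ 5)) :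
    (Set.range φ).ncard + k * Y.card ≤ numEdges G + 1 := by
  classical
  let R : Finset (Fin r) := (Set.range φ).toFinset
  have hR : ∀ e, φ e ∈ R := fun e => Set.mem_toFinset.2 ⟨e, rfl⟩
  have hpos : ∀ c ∈ R, 0 < numEdges (φ.labelGraph c) := by
    intro c hc
    obtain ⟨e, rfl⟩ := Set.mem_toFinset.1 hc
    exact (Set.ncard_pos (Set.toFinite _)).2 ⟨e.1, mem_edgeSet_labelGraph.2 ⟨e.2, rfl⟩⟩
  have h := hφ.mul_le_sum hk hbip hkX hXY hk' hR hpos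
  have hsum : ∑ c ∈ R, (numEdges (φ.labelGraph c) - 1) + R.card = numEdges G := by
    rw [← sum_numEdges_labelGraph φ hR, Finset.card_eq_sum_ones, ← Finset.sum_add_distrib]
    exact Finset.sum_congr rfl fun c hc => Nat.sub_add_cancel (hpos c hc)
  rw [Set.ncard_eq_toFinset_card']
  change R.card + _ ≤ _
  omega

end MonoConn

theorem mainTheorem4 {V : Type*} [Finite V] (G H : SimpleGraph V) (X Y : Set V) (s t k : ℕ)
    (hk : (k = 2 ∨ k = 3) ∨ (s = t ∧ (k = 2 ∨ k = 3 ∨ k = 4 ∨ k = 5)))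
    (hks : k ≤ s) (hst : s ≤ t)
    (hbip : G.IsBipartiteWith X Y) (hXY : X ∪ Y = Set.univ)
    (hX : X.ncard = s) (hY : Y.ncard = t)
    (hG : MonoConn.IsKConnected G k)
    (hH : MonoConn.IsMinSpanningKConnected G H k)
    (he : MonoConn.numEdges H = k * t) :
    (MonoConn.mc G k : ℤ) = (MonoConn.numEdges G : ℤ) - (k : ℤ) * (t : ℤ) + 1 := by
  classical
  obtain ⟨hle, hHk, -⟩ := hH
  have hk2 : 2 ≤ k := by omega
  have hkt : 0 < k * t := Nat.mul_pos (by omega) (by omega)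
  have hEle : MonoConn.numEdges H ≤ MonoConn.numEdges G :=
    Set.ncard_le_ncard (SimpleGraph.edgeSet_mono hle) (Set.toFinite _)
  obtain ⟨X, rfl⟩ := (Set.toFinite X).exists_finset_coe
  obtain ⟨Y, rfl⟩ := (Set.toFinite Y).exists_finset_coe
  rw [Set.ncard_coe_finset] at hX hY
  have hgreatest : IsGreatest (MonoConn.colourCounts G k)
      (MonoConn.numEdges G - MonoConn.numEdges H + 1) := by
    refine ⟨MonoConn.mem_colourCounts_of_isKConnected hle hHk (he ▸ hkt), ?_⟩
    rintro _ ⟨r, φ, hφ, rfl⟩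
    have := hφ.ncard_range_add_le hk2 hbip (by omega) (by omega) (by omega)
    rw [hY] at this
    omega
  rw [MonoConn.mc, hgreatest.csSup_eq]
  rw [Nat.cast_add, Nat.cast_sub hEle, he, Nat.cast_mul, Nat.cast_one]
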